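/- A convex polytope in $\mathbb{R}^m$ is \emph{integral} if all its vertices lie in $\mathbb{Z}^m$. An integral convex polytope $R\subset\mathbb{R}^m$ has the \emph{integer decomposition property} (IDP) if for every integer $n\ge 1$ and every $\gamma\in nR\cap\mathbb{Z}^m$, where $nR=\{n\alpha:\alpha\in R\}$, there exist $\gamma^{(1)},\dots,\gamma^{(n)}\in R\cap\mathbb{Z}^m$ with $\gamma=\gamma^{(1)}+\dots+\gamma^{(n)}$. For $P\subset\mathbb{R}^d$ and $Q\subset\mathbb{R}^e$ containing the origin, let $\mu:\mathbb{R}^d\to\mathbb{R}^{d+e}$, $\mu(\alpha)=(\alpha,0)$, and $\nu:\mathbb{R}^e\to\mathbb{R}^{d+e}$, $\nu(\beta)=(0,\beta)$; the \emph{free sum} $P\oplus Q\subset\mathbb{R}^{d+e}$ is the convex hull of $\mu(P)\cup\nu(Q)$. **Theorem.** Let $P\subset\mathbb{R}^d$ and $Q\subset\mathbb{R}^e$ be integral convex polytopes of dimension $d$ and $e$, respectively, each containing the origin. Suppose that $P\cap\mathbb{Z}^d$ generates the group $\mathbb{Z}^d$, that $Q\cap\mathbb{Z}^e$ generates the group $\mathbb{Z}^e$,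 and that $$(P\oplus Q)\cap\mathbb{Z}^{d+e}=\mu(P\cap\mathbb{Z}^d)\cup\nu(Q\cap\mathbb{Z}^e).$$ Then $P\oplus Q$ has the IDP if and only if both of the following conditions hold: (a) each of $P$ and $Q$ has the IDP; (b) at least one of $P$ and $Q$ has the property that the affine hull of each of its facets is the solution set of an equation $\sum_i a_i z_i=b$ with all $a_i\in\mathbb{Z}$ and $b\in\{0,1\}$. -/

import Mathlib

open scoped Pointwise

/-- The lattice `ℤ^d` inside `ℝ^d`: the points all of whose coordinates are integers. -/
def intLattice (d : ℕ) : AddSubgroup (Fin d → ℝ) where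
  carrier := {x | ∀ i, ∃ m : ℤ, x i = (m : ℝ)}
  zero_mem' := fun _ => ⟨0, by simp⟩
  add_mem' := by
    intro x y hx hy i
    obtain ⟨m, hm⟩ := hx i
    obtain ⟨n, hn⟩ := hy i
    exact ⟨m + n, by simp [hm, hn]⟩
  neg_mem' := by
    intro x hx i
    obtain ⟨m, hm⟩ := hx i
    exact ⟨-m, by simp [hm]⟩

/-- The set `P ∩ ℤ^d` of lattice points of `P`. -/
def latticePoints {d : ℕ} (P : Set (Fin d → ℝ)) : Set (Fin d → ℝ) :=
  P ∩ (intLattice d : Set (Fin d → ℝ))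

/-- An integral convex polytope in `ℝ^d`: the convex hull of a finite set of points,
all of whose vertices lie in `ℤ^d`. -/
def IsIntegralPolytope {d : ℕ} (P : Set (Fin d → ℝ)) : Prop :=
  (∃ S : Set (Fin d → ℝ), S.Finite ∧ P = convexHull ℝ S) ∧
    ∀ v ∈ P.extremePoints ℝ, v ∈ intLattice d

/-- The dimension of a (nonempty) set in `ℝ^d`, i.e. the dimension of its affine hull. -/
noncomputable def polytopeDim {d : ℕ} (P : Set (Fin d → ℝ)) : ℕ :=
  Module.finrank ℝ (vectorSpan ℝ P)

/-- The canonical injection `ℝ^d → ℝ^(d+e)`, `α ↦ (α, 0)`. -/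
def inlPoint {d : ℕ} (e : ℕ) (α : Fin d → ℝ) : Fin (d + e) → ℝ :=
  Fin.append α (0 : Fin e → ℝ)

/-- The canonical injection `ℝ^e → ℝ^(d+e)`, `β ↦ (0, β)`. -/
def inrPoint (d : ℕ) {e : ℕ} (β : Fin e → ℝ) : Fin (d + e) → ℝ :=
  Fin.append (0 : Fin d → ℝ) β

/-- The free sum `P ⊕ Q` in `ℝ^(d+e)`. -/
def freeSum {d e : ℕ} (P : Set (Fin d → ℝ)) (Q : Set (Fin e → ℝ)) : Set (Fin (d + e) → ℝ) :=
  convexHull ℝ (inlPoint e '' P ∪ inrPoint d '' Q)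

/-- The integer decomposition property: for each `n ≥ 1`, every lattice point of `nP` is
a sum of `n` lattice points of `P`. -/
def HasIDP {d : ℕ} (P : Set (Fin d → ℝ)) : Prop :=
  ∀ n : ℕ, 1 ≤ n → ∀ γ ∈ latticePoints ((n : ℝ) • P),
    ∃ g : Fin n → (Fin d → ℝ), (∀ i, g i ∈ latticePoints P) ∧ γ = ∑ i, g i

/-- `F` is a facet of `P`: a nonempty face of `P` (the set of maximizers on `P` of a linear
functional) of dimension `dim P - 1`. -/
def IsFacet {d : ℕ} (P F : Set (Fin d → ℝ)) : Prop :=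
  F.Nonempty ∧ IsExposed ℝ P F ∧ polytopeDim F + 1 = polytopeDim P

/-- The affine hull of each facet of `P` is the solution set of an equation
`a₁ z₁ + ⋯ + a_d z_d = b` with all `aᵢ` integers and `b ∈ {0, 1}`. -/
def HasUnitFacetEquations {d : ℕ} (P : Set (Fin d → ℝ)) : Prop :=
  ∀ F : Set (Fin d → ℝ), IsFacet P F →
    ∃ (a : Fin d → ℤ) (b : ℤ), (b = 0 ∨ b = 1) ∧
      (affineSpan ℝ F : Set (Fin d → ℝ)) = {z | ∑ i, (a i : ℝ) * z i = (b : ℝ)}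

/-! A point (α, β) lies in n(P ⊕ Q) exactly when α ∈ tP and β ∈ sQ for some real t, s ≥ 0 with t + s
= n. By the hypothesis on lattice points, a decomposition into n lattice points of P ⊕ Q sends k
summands to P and l to Q, with k + l = n. So, beyond IDP of P and Q, the question is whether t and s
can be replaced by integers with the same sum.

If P has unit facet equations, the facets off the origin lie on hyperplanes u = 1 with u integral.
As u(α) is then an integer, t may be lowered to its floor (`mem_floor_smul`), and s grows to an
integer. The facet comes from a linear programming argument (`exists_functional_span_tight`).

If both conditions fail, each polytope has a facet u = 1 with u not integral. The cone over it
contains a lattice point α ∈ u(α)P with fractional part of u(α) in (0, 1/2]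
(`exists_lattice_ray_fract`). Pairing two such points, the fractional parts share one extra unit of
dilation, whereas integer factors would need one unit each. -/

/-! ### Linear programming: passing to a vertex of the dual polyhedron -/

/-- While the tight constraints do not span, `u` can move along a direction vanishing on them,
without decreasing the objective, until another constraint becomes tight. -/
theorem exists_functional_span_tight {E : Type*} [AddCommGroup E] [Module ℝ E] (S : Finset E)
    (hS : Submodule.span ℝ (S : Set E) = ⊤) (c : E → ℝ) (hc : ∀ v ∈ S, 0 ≤ c v)
    (u : Module.Dual ℝ E) (hu : ∀ v ∈ S, u v ≤ 1) :
    ∃ u' : Module.Dual ℝ E, (∀ v ∈ S, u' v ≤ 1) ∧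
      u (∑ v ∈ S, c v • v) ≤ u' (∑ v ∈ S, c v • v) ∧
      Submodule.span ℝ {v | v ∈ S ∧ u' v = 1} = ⊤ := by
  classical
  induction hk : (S.filter fun v => u v ≠ 1).card using Nat.strong_induction_on generalizing u with
  | _ k ih =>
  by_cases htop : Submodule.span ℝ {v | v ∈ S ∧ u v = 1} = ⊤
  · exact ⟨u, hu, le_rfl, htop⟩
  obtain ⟨w, hw0, hw⟩ := Submodule.exists_le_ker_of_lt_top _ (lt_top_iff_ne_top.2 htop)
  have hwT : ∀ v ∈ S, u v = 1 → w v = 0 := fun v hv h =>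
    hw (Submodule.subset_span ⟨hv, h⟩)
  -- `w'` is `w` or `-w`. A positive objective forces a positive value on some generator; if the
  -- objective is zero, the sign is chosen from a generator where `w` is nonzero.
  obtain ⟨w', hw'T, hw'α, v₀, hv₀, hwv₀⟩ : ∃ w' : Module.Dual ℝ E,
      (∀ v ∈ S, u v = 1 → w' v = 0) ∧ 0 ≤ w' (∑ v ∈ S, c v • v) ∧ ∃ v ∈ S, 0 < w' v := by
    obtain ⟨v, hv, hwv⟩ : ∃ v ∈ S, w v ≠ 0 := by
      by_contra! h
      refine hw0 (LinearMap.ext_on hS (fun v hv => ?_))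
      simpa using h v hv
    have key : ∀ f : Module.Dual ℝ E, 0 < f (∑ v ∈ S, c v • v) → ∃ v ∈ S, 0 < f v := by
      intro f hf
      by_contra! h
      have : f (∑ v ∈ S, c v • v) ≤ 0 := by
        rw [map_sum]
        refine Finset.sum_nonpos fun v hv => ?_
        rw [map_smul, smul_eq_mul]
        exact mul_nonpos_of_nonneg_of_nonpos (hc v hv) (h v hv)
      linarith
    have hneg : ∀ v ∈ S, u v = 1 → (-w) v = 0 := fun v hv h => by simp [hwT v hv h]
    rcases lt_trichotomy (w (∑ v ∈ S, c v • v)) 0 with h | h | h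
    · have h' : 0 < (-w) (∑ v ∈ S, c v • v) := by rw [LinearMap.neg_apply]; linarith
      exact ⟨-w, hneg, h'.le, key _ h'⟩
    · rcases hwv.lt_or_gt with h1 | h1
      · exact ⟨-w, hneg, by rw [LinearMap.neg_apply]; linarith, v, hv, by
          rw [LinearMap.neg_apply]; linarith⟩
      · exact ⟨w, hwT, h.ge, v, hv, h1⟩
    · exact ⟨w, hwT, h.le, key _ h⟩
  -- Ratio test: `m` is the first constraint met when moving along `w'`.
  obtain ⟨m, hm, hmin⟩ := (S.filter fun v => 0 < w' v).exists_min_image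
    (fun v => (1 - u v) / w' v) ⟨v₀, by simp [hv₀, hwv₀]⟩
  rw [Finset.mem_filter] at hm
  set τ := (1 - u m) / w' m with hτ
  have hτ0 : 0 ≤ τ := div_nonneg (by linarith [hu m hm.1]) hm.2.le
  have hum : u m ≠ 1 := fun h => by simp [hw'T m hm.1 h] at hm
  have hu₁ : ∀ v ∈ S, (u + τ • w') v ≤ 1 := by
    intro v hv
    simp only [LinearMap.add_apply, LinearMap.smul_apply, smul_eq_mul]
    by_cases hpos : 0 < w' v
    · have := hmin v (by simp [hv, hpos])
      rw [le_div_iff₀ hpos] at this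
      linarith
    · have := mul_nonpos_of_nonneg_of_nonpos hτ0 (not_lt.1 hpos)
      linarith [hu v hv]
  obtain ⟨u', h1, h2, h3⟩ := ih _ (by
    rw [← hk]
    apply Finset.card_lt_card
    rw [Finset.ssubset_iff_of_subset]
    · refine ⟨m, by simp [hm.1, hum], ?_⟩
      have : u m + τ * w' m = 1 := by rw [hτ, div_mul_cancel₀ _ hm.2.ne']; ring
      simp [this]
    · intro v hv
      rw [Finset.mem_filter] at hv ⊢
      refine ⟨hv.1, fun h => hv.2 ?_⟩
      simp [h, hw'T v hv.1 h]) (u + τ • w') hu₁ rfl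
  refine ⟨u', h1, le_trans ?_ h2, h3⟩
  simp only [LinearMap.add_apply, LinearMap.smul_apply, smul_eq_mul]
  have := mul_nonneg hτ0 hw'α
  linarith

/-! ### Vertices, spans and hyperplanes -/

theorem IsIntegralPolytope.exists_finset {d : ℕ} {P : Set (Fin d → ℝ)}
    (hP : IsIntegralPolytope P) :
    ∃ S : Finset (Fin d → ℝ), P = convexHull ℝ (S : Set (Fin d → ℝ)) ∧
      ∀ v ∈ S, v ∈ intLattice d := by
  obtain ⟨⟨S, hS, rfl⟩, hext⟩ := hP
  have hfin : ((convexHull ℝ S).extremePoints ℝ).Finite :=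
    hS.subset extremePoints_convexHull_subset
  refine ⟨hfin.toFinset, ?_, fun v hv => hext v (by simpa using hv)⟩
  rw [hfin.coe_toFinset]
  conv_lhs => rw [← closure_convexHull_extremePoints (hS.isCompact_convexHull ℝ)
    (convex_convexHull ℝ S)]
  exact (hfin.isClosed_convexHull ℝ).closure_eq

theorem span_eq_top_of_polytopeDim {d : ℕ} {P S : Set (Fin d → ℝ)} (hPS : P = convexHull ℝ S)
    (hdim : polytopeDim P = d) : Submodule.span ℝ S = ⊤ := by
  have h1 : vectorSpan ℝ P = ⊤ := Submodule.eq_top_of_finrank_eq (by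
    rw [Module.finrank_fin_fun]; exact hdim)
  rw [eq_top_iff, ← h1, vectorSpan_def, Submodule.span_le]
  have h2 : ∀ x ∈ P, x ∈ Submodule.span ℝ S := by
    rw [hPS]
    exact convexHull_min Submodule.subset_span (Submodule.convex _)
  rintro _ ⟨x, hx, y, hy, rfl⟩
  exact Submodule.sub_mem _ (h2 x hx) (h2 y hy)

theorem vectorSpan_le_ker {E : Type*} [AddCommGroup E] [Module ℝ E] {F : Set E}
    {u : Module.Dual ℝ E} {c : ℝ} (hF : ∀ x ∈ F, u x = c) :
    vectorSpan ℝ F ≤ LinearMap.ker u := by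
  rw [vectorSpan_def, Submodule.span_le]
  rintro _ ⟨x, hx, y, hy, rfl⟩
  simp [hF x hx, hF y hy]

theorem finrank_ker_add_one {E : Type*} [AddCommGroup E] [Module ℝ E] [FiniteDimensional ℝ E]
    {u : Module.Dual ℝ E} (hu : u ≠ 0) :
    Module.finrank ℝ (LinearMap.ker u) + 1 = Module.finrank ℝ E :=
  Module.Dual.finrank_ker_add_one_of_ne_zero hu

theorem span_le_vectorSpan_sup {E : Type*} [AddCommGroup E] [Module ℝ E] {F : Set E} {p : E}
    (hp : p ∈ F) : Submodule.span ℝ F ≤ vectorSpan ℝ F ⊔ Submodule.span ℝ {p} := by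
  rw [Submodule.span_le]
  intro x hx
  have : x = (x - p) + p := by abel
  rw [this]
  exact Submodule.add_mem_sup (vsub_mem_vectorSpan ℝ hx hp) (Submodule.mem_span_singleton_self p)

/-- The vector span of a set on which `u` is constant has codimension one if the set spans. -/
theorem finrank_vectorSpan_add_one {E : Type*} [AddCommGroup E] [Module ℝ E]
    [FiniteDimensional ℝ E] {F : Set E} {u : Module.Dual ℝ E} (hF : ∀ x ∈ F, u x = 1)
    (hne : F.Nonempty) (hspan : Submodule.span ℝ F = ⊤) :
    Module.finrank ℝ (vectorSpan ℝ F) + 1 = Module.finrank ℝ E := by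
  obtain ⟨p, hp⟩ := hne
  have hu : u ≠ 0 := by rintro rfl; simpa using hF p hp
  have h1 := Submodule.finrank_mono (vectorSpan_le_ker hF)
  have h2 := finrank_ker_add_one hu
  have h3 : vectorSpan ℝ F ⊔ Submodule.span ℝ {p} = ⊤ :=
    top_le_iff.1 (hspan ▸ span_le_vectorSpan_sup hp)
  have h4 := Submodule.finrank_add_le_finrank_add_finrank (vectorSpan ℝ F)
    (Submodule.span ℝ {p})
  rw [h3, finrank_top] at h4
  have h5 := finrank_span_le_card (R := ℝ) ({p} : Set E)
  simp at h5
  omega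

/-- A set of codimension one on a hyperplane affinely spans the hyperplane. -/
theorem affineSpan_eq_of_finrank {E : Type*} [AddCommGroup E] [Module ℝ E]
    [FiniteDimensional ℝ E] {F : Set E} {u : Module.Dual ℝ E} {c : ℝ} (hu : u ≠ 0)
    (hF : ∀ x ∈ F, u x = c) (hne : F.Nonempty)
    (hdim : Module.finrank ℝ (vectorSpan ℝ F) + 1 = Module.finrank ℝ E) :
    vectorSpan ℝ F = LinearMap.ker u ∧ (affineSpan ℝ F : Set E) = {z | u z = c} := by
  obtain ⟨p, hp⟩ := hne
  have h1 : vectorSpan ℝ F = LinearMap.ker u :=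
    Submodule.eq_of_le_of_finrank_eq (vectorSpan_le_ker hF) (by
      have := finrank_ker_add_one hu
      omega)
  refine ⟨h1, ?_⟩
  ext z
  rw [SetLike.mem_coe, ← AffineSubspace.vsub_right_mem_direction_iff_mem
    (subset_affineSpan ℝ F hp), direction_affineSpan, h1]
  simp [sub_eq_zero, hF p hp]

/-- The weighted average of the nonnegative slacks `c - u v` is zero, so only tight points carry
weight. -/
theorem mem_span_tight {E : Type*} [AddCommGroup E] [Module ℝ E] {S : Finset E}
    {u : Module.Dual ℝ E} {c : ℝ} (hS : ∀ v ∈ S, u v ≤ c) {x : E}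
    (hx : x ∈ convexHull ℝ (S : Set E)) (hux : u x = c) :
    x ∈ Submodule.span ℝ {v | v ∈ S ∧ u v = c} := by
  rw [Finset.mem_convexHull'] at hx
  obtain ⟨w, hw0, hw1, rfl⟩ := hx
  have hsum : ∑ v ∈ S, w v * (c - u v) = 0 := by
    simp only [mul_sub, Finset.sum_sub_distrib, ← Finset.sum_mul, hw1, one_mul]
    rw [map_sum] at hux
    simp only [map_smul, smul_eq_mul] at hux
    rw [hux, sub_self]
  rw [Finset.sum_eq_zero_iff_of_nonneg fun v hv =>
    mul_nonneg (hw0 v hv) (sub_nonneg.2 (hS v hv))] at hsum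
  refine Submodule.sum_mem _ fun v hv => ?_
  rcases mul_eq_zero.1 (hsum v hv) with h | h
  · simp [h]
  · exact Submodule.smul_mem _ _ (Submodule.subset_span ⟨hv, by linarith⟩)

/-- A finite set of integer vectors that does not span `ℝ^d` is orthogonal to some nonzero
integer vector. -/
theorem exists_int_orthogonal {d : ℕ} {T : Set (Fin d → ℝ)}
    (hT : ∀ v ∈ T, v ∈ intLattice d) (hspan : Submodule.span ℝ T ≠ ⊤) :
    ∃ a : Fin d → ℤ, a ≠ 0 ∧ ∀ v ∈ T, ∑ i, (a i : ℝ) * v i = 0 := by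
  obtain ⟨b, hbT, hbspan, hbli⟩ := exists_linearIndependent ℝ T
  have hfin : b.Finite := hbli.setFinite
  have : Fintype b := hfin.fintype
  have hcard : Fintype.card b < d := by
    have h1 := finrank_span_set_eq_card hbli
    rw [hbspan] at h1
    have h2 := Submodule.finrank_lt (lt_top_iff_ne_top.2 hspan).ne
    rw [Module.finrank_fin_fun] at h2
    rw [Set.toFinset_card] at h1
    exact h1 ▸ h2
  obtain ⟨f⟩ : Nonempty (b ↪ Fin d) := Function.Embedding.nonempty_of_card_le (by
    simpa using hcard.le)
  have hnsurj : ¬ Function.Surjective f := fun h => by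
    have := Fintype.card_le_of_surjective f h
    rw [Fintype.card_fin] at this
    omega
  rw [Function.Surjective] at hnsurj
  push Not at hnsurj
  obtain ⟨i₀, hi₀⟩ := hnsurj
  choose! m hm using hT
  -- A basis of the span, padded by zero rows to a square integer matrix; row `i₀` is zero, so the
  -- matrix is singular and has an integer kernel vector.
  let M : Matrix (Fin d) (Fin d) ℤ := Function.extend f (fun v => m v.1) 0
  have hM : M.det = 0 := Matrix.det_eq_zero_of_row_eq_zero i₀ (fun j => by
    simp only [M]
    rw [Function.extend_apply' _ _ _ (by simpa using hi₀)]
    rfl)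
  obtain ⟨a, ha0, ha⟩ := Matrix.exists_mulVec_eq_zero_iff.2 hM
  let A : Module.Dual ℝ (Fin d → ℝ) := ∑ i, (a i : ℝ) • LinearMap.proj i
  have hA : ∀ v, A v = ∑ i, (a i : ℝ) * v i := fun v => by simp [A]
  refine ⟨a, ha0, fun v hv => ?_⟩
  have hle : Submodule.span ℝ b ≤ LinearMap.ker A := by
    rw [Submodule.span_le]
    intro v hv
    rw [SetLike.mem_coe, LinearMap.mem_ker, hA]
    have h := congrFun ha (f ⟨v, hv⟩)
    simp only [Matrix.mulVec, dotProduct, M, f.injective.extend_apply, Pi.zero_apply] at h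
    have h' : ((∑ i, m v i * a i : ℤ) : ℝ) = 0 := by exact_mod_cast h
    push_cast at h'
    rw [← h']
    exact Finset.sum_congr rfl fun i _ => by rw [hm v (hbT hv) i, mul_comm]
  rw [← hA]
  exact hle (hbspan ▸ Submodule.subset_span hv)

/-! ### Rounding down under unit facet equations -/

/-- If no facet obstructs, dilation factors of lattice points may be rounded down. -/
theorem mem_floor_smul {d : ℕ} {P : Set (Fin d → ℝ)} (hP : IsIntegralPolytope P)
    (hdim : polytopeDim P = d) (h0 : (0 : Fin d → ℝ) ∈ P) (hunit : HasUnitFacetEquations P)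
    {t : ℝ} (ht : 0 ≤ t) {α : Fin d → ℝ} (hα : α ∈ intLattice d) (hαt : α ∈ t • P) :
    α ∈ (⌊t⌋₊ : ℝ) • P := by
  obtain ⟨S, hPS, -⟩ := hP.exists_finset
  have hspan := span_eq_top_of_polytopeDim hPS hdim
  set m := ⌊t⌋₊ with hm
  by_contra hnot
  have hconv : Convex ℝ P := hPS ▸ convex_convexHull ℝ _
  have hcomp : IsCompact P := hPS ▸ S.finite_toSet.isCompact_convexHull ℝ
  have hSP : ∀ v ∈ S, v ∈ P := fun v hv => hPS ▸ subset_convexHull ℝ _ hv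
  have hmP0 : (0 : Fin d → ℝ) ∈ (m : ℝ) • P := ⟨0, h0, smul_zero _⟩
  obtain ⟨f, s, hfs, hsα⟩ := geometric_hahn_banach_closed_point (hconv.smul (m : ℝ))
    (hcomp.smul (m : ℝ)).isClosed hnot
  have hs0 : 0 < s := by simpa using hfs 0 hmP0
  -- `K` rescales `f` to be at most 1 on `S`. For `m = 0` any positive upper bound works, since `f
  -- α` is positive.
  obtain ⟨K, hK0, hK, hKα⟩ : ∃ K : ℝ, 0 < K ∧ (∀ v ∈ S, f v ≤ K) ∧ m * K < f α := by
    rcases Nat.eq_zero_or_pos m with h | h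
    · refine ⟨1 + ∑ v ∈ S, |f v|, by positivity, fun v hv => ?_, by simp [h]; linarith⟩
      have := Finset.single_le_sum (f := fun v => |f v|) (fun v _ => abs_nonneg _) hv
      linarith [le_abs_self (f v)]
    · have hmpos : (0 : ℝ) < m := by exact_mod_cast h
      refine ⟨s / m, by positivity, fun v hv => ?_, by rwa [mul_div_cancel₀ _ hmpos.ne']⟩
      have := hfs _ (Set.smul_mem_smul_set (hSP v hv))
      rw [map_smul, smul_eq_mul] at this
      rw [le_div_iff₀ hmpos]
      linarith
  obtain ⟨x, hxP, hxα⟩ := hαt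
  have hx := hxP
  rw [hPS, Finset.mem_convexHull'] at hx
  obtain ⟨w, hw0, hw1, hwx⟩ := hx
  have hαsum : ∑ v ∈ S, (t * w v) • v = α := by
    rw [← hxα, ← hwx]
    simp [Finset.smul_sum, smul_smul]
  obtain ⟨u, hu1, huα, hutop⟩ := exists_functional_span_tight S hspan (fun v => t * w v)
    (fun v hv => mul_nonneg ht (hw0 v hv)) (K⁻¹ • (f : Module.Dual ℝ (Fin d → ℝ)))
    (fun v hv => by
      simp only [LinearMap.smul_apply, smul_eq_mul, ContinuousLinearMap.coe_coe]
      rw [inv_mul_le_iff₀ hK0]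
      linarith [hK v hv])
  rw [hαsum] at huα
  have hmu : (m : ℝ) < u α := by
    refine lt_of_lt_of_le ?_ huα
    simp only [LinearMap.smul_apply, smul_eq_mul, ContinuousLinearMap.coe_coe]
    rw [lt_inv_mul_iff₀ hK0]
    linarith
  have huP : ∀ y ∈ P, u y ≤ 1 := by
    rw [hPS]
    exact convexHull_min (fun v hv => hu1 v hv) (convex_halfSpace_le u.isLinear 1)
  have hut : u α ≤ t := by
    rw [← hxα]
    simp only [map_smul, smul_eq_mul]
    nlinarith [huP x hxP]
  have hα0 : α ≠ 0 := by
    rintro rfl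
    exact hnot hmP0
  have hTne : {v | v ∈ S ∧ u v = 1}.Nonempty := by
    by_contra! h
    rw [h, Submodule.span_empty] at hutop
    have := (hutop ▸ Submodule.mem_top : α ∈ (⊥ : Submodule ℝ (Fin d → ℝ)))
    exact hα0 (by simpa using this)
  obtain ⟨p, hpS, hp1⟩ := hTne
  set F : Set (Fin d → ℝ) := {y | y ∈ P ∧ u y = 1} with hF
  have hTF : {v | v ∈ S ∧ u v = 1} ⊆ F := fun v hv => ⟨hSP v hv.1, hv.2⟩
  have hFne : F.Nonempty := ⟨p, hTF ⟨hpS, hp1⟩⟩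
  have hfacet : IsFacet P F := by
    refine ⟨hFne, fun _ => ⟨LinearMap.toContinuousLinearMap u, ?_⟩, ?_⟩
    · ext y
      simp only [hF, Set.mem_ofPred_eq, LinearMap.coe_toContinuousLinearMap']
      refine and_congr_right fun hy => ⟨fun h z hz => h ▸ huP z hz, fun h => ?_⟩
      exact le_antisymm (huP y hy) (hp1 ▸ h p (hSP p hpS))
    · rw [hdim]
      have := finrank_vectorSpan_add_one (F := F) (u := u) (fun x hx => hx.2) hFne
        (top_le_iff.1 (hutop ▸ Submodule.span_mono hTF))
      rw [Module.finrank_fin_fun] at this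
      exact this
  obtain ⟨a, b, hb, hab⟩ := hunit F hfacet
  let A : Module.Dual ℝ (Fin d → ℝ) := ∑ i, (a i : ℝ) • LinearMap.proj i
  have hA : ∀ v, A v = ∑ i, (a i : ℝ) * v i := fun v => by simp [A]
  -- The origin is off the hyperplane u = 1, which excludes b = 0.
  have hb1 : b = 1 := by
    refine hb.resolve_left ?_
    rintro rfl
    have h1 : (0 : Fin d → ℝ) ∈ (affineSpan ℝ F : Set (Fin d → ℝ)) := by simp [hab]
    rw [SetLike.mem_coe, ← AffineSubspace.vsub_right_mem_direction_iff_mem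
      (subset_affineSpan ℝ F hFne.some_mem), direction_affineSpan] at h1
    have h2 := vectorSpan_le_ker (fun x hx => hx.2 : ∀ x ∈ F, u x = 1) h1
    simp [hFne.some_mem.2] at h2
  have huA : u = A := LinearMap.ext_on hutop (fun v hv => by
    have : v ∈ (affineSpan ℝ F : Set (Fin d → ℝ)) := subset_affineSpan ℝ F (hTF hv)
    rw [hab, hb1] at this
    rw [hA, hv.2]
    simpa using this.symm)
  choose z hz using hα
  -- `u α` is an integer in (⌊t⌋, t], which is impossible.
  have hint : u α = ((∑ i, a i * z i : ℤ) : ℝ) := by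
    rw [huA, hA]
    push_cast
    exact Finset.sum_congr rfl fun i _ => by rw [hz i]
  rw [hint] at hmu hut
  have h1 : (m : ℤ) < ∑ i, a i * z i := by exact_mod_cast hmu
  have h2 : ((m : ℤ) + 1 : ℤ) ≤ ∑ i, a i * z i := h1
  have h3 : (((m : ℤ) + 1 : ℤ) : ℝ) ≤ ((∑ i, a i * z i : ℤ) : ℝ) := by exact_mod_cast h2
  have h4 := Nat.lt_floor_add_one t
  push_cast at h3 hut
  rw [← hm] at h4
  linarith

/-! ### Lattice points with small fractional height over a bad facet -/

/-- Some basis vector has a non-integer value, and negating it replaces the fractional part f by 1 -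
f. The bound 1/2 lets two such parts fit in one unit. -/
theorem exists_intLattice_fract {d : ℕ} (u : Module.Dual ℝ (Fin d → ℝ))
    (hu : ¬ ∃ a : Fin d → ℤ, ∀ z, u z = ∑ i, (a i : ℝ) * z i) :
    ∃ z ∈ intLattice d, 0 < Int.fract (u z) ∧ Int.fract (u z) ≤ 1 / 2 := by
  have hrepr : ∀ z, u z = ∑ i, u (Pi.single i 1) * z i := by
    intro z
    conv_lhs => rw [pi_eq_sum_univ' z, map_sum]
    exact Finset.sum_congr rfl fun i _ => by
      rw [map_smul, smul_eq_mul, mul_comm]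
  obtain ⟨i, hi⟩ : ∃ i, Int.fract (u (Pi.single i 1)) ≠ 0 := by
    by_contra! h
    refine hu ⟨fun i => ⌊u (Pi.single i 1)⌋, fun z => ?_⟩
    rw [hrepr z]
    refine Finset.sum_congr rfl fun i _ => ?_
    have := Int.self_sub_floor (u (Pi.single i 1))
    rw [h i, sub_eq_zero] at this
    rw [← this]
  have hmem : (Pi.single i 1 : Fin d → ℝ) ∈ intLattice d := by
    intro j
    rcases eq_or_ne j i with rfl | h
    · exact ⟨1, by simp⟩
    · exact ⟨0, by simp [h]⟩
  have hpos := (Int.fract_nonneg (u (Pi.single i 1))).lt_of_ne' hi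
  by_cases hle : Int.fract (u (Pi.single i 1)) ≤ 1 / 2
  · exact ⟨_, hmem, hpos, hle⟩
  · refine ⟨-Pi.single i 1, neg_mem hmem, ?_⟩
    rw [map_neg, Int.fract_neg hi]
    have := Int.fract_lt_one (u (Pi.single i 1))
    constructor <;> linarith

theorem exists_lattice_ray_fract {d : ℕ} {P : Set (Fin d → ℝ)} (hP : IsIntegralPolytope P)
    (hdim : polytopeDim P = d) (h0 : (0 : Fin d → ℝ) ∈ P) (hunit : ¬ HasUnitFacetEquations P) :
    ∃ (u : Module.Dual ℝ (Fin d → ℝ)) (α : Fin d → ℝ), (∀ x ∈ P, u x ≤ 1) ∧ α ∈ intLattice d ∧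
      0 ≤ u α ∧ α ∈ u α • P ∧ 0 < Int.fract (u α) ∧ Int.fract (u α) ≤ 1 / 2 := by
  classical
  obtain ⟨S, hPS, hSint⟩ := hP.exists_finset
  have hSP : ∀ v ∈ S, v ∈ P := fun v hv => hPS ▸ subset_convexHull ℝ _ hv
  rw [HasUnitFacetEquations] at hunit
  push Not at hunit
  obtain ⟨F, ⟨hne, hexp, hFdim⟩, hF⟩ := hunit
  obtain ⟨l, hl⟩ := hexp hne
  obtain ⟨p, hp⟩ := id hne
  have hpP : p ∈ P := by rw [hl] at hp; exact hp.1
  have hlP : ∀ y ∈ P, l y ≤ l p := by rw [hl] at hp; exact hp.2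
  have hFl : ∀ x, x ∈ F ↔ x ∈ P ∧ l x = l p := by
    intro x
    constructor
    · intro hx
      have hxP : x ∈ P := by rw [hl] at hx; exact hx.1
      refine ⟨hxP, le_antisymm (hlP x hxP) ?_⟩
      rw [hl] at hx
      exact hx.2 p hpP
    · rintro ⟨hxP, hx⟩
      rw [hl]
      exact ⟨hxP, fun y hy => hx ▸ hlP y hy⟩
  have hl0 : (l : Module.Dual ℝ (Fin d → ℝ)) ≠ 0 := by
    intro h
    have hzero : ∀ x, l x = 0 := fun x => LinearMap.congr_fun h x
    have : F = P := by
      ext x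
      simp [hFl, hzero]
    rw [this] at hFdim
    omega
  have hFdim' : Module.finrank ℝ (vectorSpan ℝ F) + 1 = Module.finrank ℝ (Fin d → ℝ) := by
    rw [Module.finrank_fin_fun]
    exact hFdim.trans hdim
  obtain ⟨hker, haff⟩ := affineSpan_eq_of_finrank hl0 (fun x hx => ((hFl x).1 hx).2) hne hFdim'
  have hspanF : F ⊆ Submodule.span ℝ {v | v ∈ S ∧ l v = l p} := fun x hx => by
    have hx' := (hFl x).1 hx
    exact mem_span_tight (u := (l : Module.Dual ℝ (Fin d → ℝ))) (fun v hv => hlP v (hSP v hv))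
      (hPS ▸ hx'.1) hx'.2
  have hc : 0 ≤ l p := by simpa using hlP 0 h0
  -- A facet hyperplane through the origin is spanned by integer points, so it has an integer
  -- equation with b = 0 and cannot be bad.
  rcases hc.eq_or_lt with hc | hc
  · exfalso
    have hT : Submodule.span ℝ {v | v ∈ S ∧ l v = l p} ≤
        LinearMap.ker (l : Module.Dual ℝ (Fin d → ℝ)) := by
      rw [Submodule.span_le]
      intro v hv
      exact hv.2.trans hc.symm
    obtain ⟨a, ha0, ha⟩ := exists_int_orthogonal (T := {v | v ∈ S ∧ l v = l p})
      (fun v hv => hSint v hv.1) (fun h => hl0 (LinearMap.ker_eq_top.1 (top_le_iff.1 (h ▸ hT))))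
    let A : Module.Dual ℝ (Fin d → ℝ) := ∑ i, (a i : ℝ) • LinearMap.proj i
    have hA : ∀ v, A v = ∑ i, (a i : ℝ) * v i := fun v => by simp [A]
    have hA0 : A ≠ 0 := by
      intro h
      refine ha0 (funext fun i => ?_)
      have := LinearMap.congr_fun h (Pi.single i 1)
      rw [hA] at this
      simpa [Pi.single_apply] using this
    have hAF : ∀ x ∈ F, A x = 0 := by
      have : Submodule.span ℝ {v | v ∈ S ∧ l v = l p} ≤ LinearMap.ker A := by
        rw [Submodule.span_le]
        intro v hv
        exact (hA v).trans (ha v hv)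
      exact fun x hx => this (hspanF hx)
    refine hF a 0 (Or.inl rfl) ?_
    rw [(affineSpan_eq_of_finrank hA0 hAF hne hFdim').2]
    simp [hA]
  · set u : Module.Dual ℝ (Fin d → ℝ) := (l p)⁻¹ • (l : Module.Dual ℝ (Fin d → ℝ)) with hu
    have hul : ∀ x, u x = (l p)⁻¹ * l x := fun x => rfl
    have hu1 : ∀ x, u x = 1 ↔ l x = l p := fun x => by
      rw [hul, inv_mul_eq_iff_eq_mul₀ hc.ne', mul_one]
    have huP : ∀ x ∈ P, u x ≤ 1 := fun x hx => by
      rw [hul, inv_mul_le_iff₀ hc, mul_one]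
      exact hlP x hx
    obtain ⟨z, hz, hz0, hz1⟩ := exists_intLattice_fract u (by
      rintro ⟨a, ha⟩
      refine hF a 1 (Or.inr rfl) ?_
      rw [haff]
      ext x
      simp only [Set.mem_ofPred_eq, ← ha, Int.cast_one, hu1]
      rfl)
    set T := S.filter fun v => l v = l p with hTdef
    have hTS : {v | v ∈ S ∧ l v = l p} = (T : Set (Fin d → ℝ)) := by ext; simp [hTdef]
    rw [hTS] at hspanF
    have htop : Submodule.span ℝ (T : Set (Fin d → ℝ)) = ⊤ := by
      have hpT : p ∈ Submodule.span ℝ (T : Set (Fin d → ℝ)) := hspanF hp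
      have hle : LinearMap.ker (l : Module.Dual ℝ (Fin d → ℝ)) ≤
          Submodule.span ℝ (T : Set (Fin d → ℝ)) := by
        rw [← hker, vectorSpan_def, Submodule.span_le]
        rintro _ ⟨x, hx, y, hy, rfl⟩
        exact Submodule.sub_mem _ (hspanF hx) (hspanF hy)
      rw [eq_top_iff]
      intro x _
      have : x = (x - (u x) • p) + u x • p := by abel
      rw [this]
      refine Submodule.add_mem _ (hle ?_) (Submodule.smul_mem _ _ hpT)
      rw [LinearMap.mem_ker, map_sub, map_smul, hul]
      simp only [ContinuousLinearMap.coe_coe, smul_eq_mul]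
      field_simp
      ring
    obtain ⟨c, -, hcz⟩ := Submodule.mem_span_finset.1 (htop ▸ Submodule.mem_top : z ∈ _)
    -- Large enough that adding `N` times every tight vertex moves `z` into the cone over the facet;
    -- each vertex has height 1, so the fractional part is unchanged.
    set N := ⌈∑ v ∈ T, |c v|⌉₊
    have hN : ∀ v ∈ T, 0 ≤ c v + N := by
      intro v hv
      have h1 := Finset.single_le_sum (f := fun v => |c v|) (fun v _ => abs_nonneg _) hv
      have h2 := Nat.le_ceil (∑ v ∈ T, |c v|)
      have h3 := neg_abs_le (c v)
      linarith
    have huT : ∀ v ∈ T, u v = 1 := fun v hv => (hu1 v).2 (Finset.mem_filter.1 hv).2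
    set α := ∑ v ∈ T, (c v + N) • v with hα
    have hα' : α = z + N • ∑ v ∈ T, v := by
      rw [hα, ← hcz]
      simp only [add_smul, Finset.sum_add_distrib, Finset.smul_sum, Nat.cast_smul_eq_nsmul]
    have huα : u α = ∑ v ∈ T, (c v + N) := by
      rw [hα, map_sum]
      exact Finset.sum_congr rfl fun v hv => by rw [map_smul, huT v hv, smul_eq_mul, mul_one]
    have hfract : Int.fract (u α) = Int.fract (u z) := by
      have : u α = u z + (N * T.card : ℕ) := by
        rw [hα', map_add, map_nsmul, map_sum, Finset.sum_congr rfl huT]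
        simp
      rw [this, Int.fract_add_natCast]
    have hnn : 0 ≤ u α := huα ▸ Finset.sum_nonneg hN
    have hpos : 0 < u α := hnn.lt_of_ne' (fun h => by
      rw [← hfract, h, Int.fract_zero] at hz0
      exact lt_irrefl _ hz0)
    refine ⟨u, α, huP, ?_, hnn, ?_, hfract ▸ hz0, hfract ▸ hz1⟩
    · rw [hα']
      exact add_mem hz (nsmul_mem (sum_mem fun v hv => hSint v (Finset.mem_filter.1 hv).1) _)
    · rw [Set.mem_smul_set_iff_inv_smul_mem₀ hpos.ne']
      have := T.centerMass_mem_convexHull (s := (S : Set (Fin d → ℝ))) (z := id) hN (huα ▸ hpos)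
        (fun v hv => (Finset.mem_filter.1 hv).1)
      rw [Finset.centerMass, ← huα] at this
      rw [hPS]
      exact this

/-! ### Sums of a prescribed number of elements -/

/-- The sums of `n` elements of `A`. -/
def IsSumOf {E : Type*} [AddCommMonoid E] (A : Set E) (n : ℕ) (x : E) : Prop :=
  ∃ g : Fin n → E, (∀ i, g i ∈ A) ∧ x = ∑ i, g i

namespace IsSumOf

variable {E G : Type*} [AddCommMonoid E] [AddCommMonoid G] {A : Set E}

theorem zero_iff {x : E} : IsSumOf A 0 x ↔ x = 0 := by
  simp [IsSumOf]

theorem succ {n : ℕ} {a x : E} (ha : a ∈ A) (hx : IsSumOf A n x) : IsSumOf A (n + 1) (a + x) := by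
  obtain ⟨g, hg, rfl⟩ := hx
  exact ⟨Fin.cons a g, Fin.cases ha hg, by simp [Fin.sum_univ_succ]⟩

theorem exists_of_succ {n : ℕ} {x : E} (hx : IsSumOf A (n + 1) x) :
    ∃ a ∈ A, ∃ y, IsSumOf A n y ∧ x = a + y := by
  obtain ⟨g, hg, rfl⟩ := hx
  exact ⟨g 0, hg 0, _, ⟨_, fun i => hg i.succ, rfl⟩, Fin.sum_univ_succ g⟩

theorem add {k l : ℕ} {x y : E} (hx : IsSumOf A k x) (hy : IsSumOf A l y) :
    IsSumOf A (k + l) (x + y) := by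
  obtain ⟨g, hg, rfl⟩ := hx
  obtain ⟨h, hh, rfl⟩ := hy
  refine ⟨Fin.append g h, fun i => ?_, by simp [Fin.sum_univ_add]⟩
  refine Fin.addCases (fun i => ?_) (fun i => ?_) i
  · simpa using hg i
  · simpa using hh i

theorem zeros (h0 : (0 : E) ∈ A) (n : ℕ) : IsSumOf A n 0 :=
  ⟨fun _ => 0, fun _ => h0, by simp⟩

theorem map {n : ℕ} {x : E} (f : E →+ G) {B : Set G} (hf : ∀ a ∈ A, f a ∈ B)
    (hx : IsSumOf A n x) : IsSumOf B n (f x) := by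
  obtain ⟨g, hg, rfl⟩ := hx
  exact ⟨fun i => f (g i), fun i => hf _ (hg i), map_sum f _ _⟩

/-- Used as a lower bound on the number of summands. -/
theorem map_le {F : Type*} [AddCommGroup F] [Module ℝ F] {A : Set F} {n : ℕ} {x : F}
    (u : Module.Dual ℝ F) (hu : ∀ a ∈ A, u a ≤ 1) (hx : IsSumOf A n x) : u x ≤ n := by
  obtain ⟨g, hg, rfl⟩ := hx
  rw [map_sum]
  exact (Finset.sum_le_sum fun i _ => hu _ (hg i)).trans (by simp)

end IsSumOf

/-- Includes n = 0, since an integer dilation factor may be zero. -/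
theorem HasIDP.isSumOf {d : ℕ} {P : Set (Fin d → ℝ)} (h : HasIDP P) {n : ℕ} {x : Fin d → ℝ}
    (hx : x ∈ intLattice d) (hxn : x ∈ (n : ℝ) • P) : IsSumOf (latticePoints P) n x := by
  rcases Nat.eq_zero_or_pos n with rfl | hn
  · obtain ⟨y, -, rfl⟩ := hxn
    simp [IsSumOf.zero_iff]
  · exact h n hn x ⟨hxn, hx⟩

/-! ### Coordinates on the direct sum -/

/-- `inlPoint` as a linear map. -/
def inlLinear (d e : ℕ) : (Fin d → ℝ) →ₗ[ℝ] (Fin (d + e) → ℝ) where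
  toFun := inlPoint e
  map_add' x y := by ext i; refine Fin.addCases (fun i => ?_) (fun i => ?_) i <;> simp [inlPoint]
  map_smul' c x := by ext i; refine Fin.addCases (fun i => ?_) (fun i => ?_) i <;> simp [inlPoint]

/-- `inrPoint` as a linear map. -/
def inrLinear (d e : ℕ) : (Fin e → ℝ) →ₗ[ℝ] (Fin (d + e) → ℝ) where
  toFun := inrPoint d
  map_add' x y := by ext i; refine Fin.addCases (fun i => ?_) (fun i => ?_) i <;> simp [inrPoint]
  map_smul' c x := by ext i; refine Fin.addCases (fun i => ?_) (fun i => ?_) i <;> simp [inrPoint]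

/-- The projection onto the first `d` coordinates. -/
def fstLinear (d e : ℕ) : (Fin (d + e) → ℝ) →ₗ[ℝ] (Fin d → ℝ) :=
  LinearMap.funLeft ℝ ℝ (Fin.castAdd e)

/-- The projection onto the last `e` coordinates. -/
def sndLinear (d e : ℕ) : (Fin (d + e) → ℝ) →ₗ[ℝ] (Fin e → ℝ) :=
  LinearMap.funLeft ℝ ℝ (Fin.natAdd d)

section Coordinates

variable {d e : ℕ}

@[simp] theorem inlLinear_apply (x : Fin d → ℝ) : inlLinear d e x = inlPoint e x := rfl

@[simp] theorem inrLinear_apply (x : Fin e → ℝ) : inrLinear d e x = inrPoint d x := rfl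

@[simp] theorem fstLinear_inlPoint (x : Fin d → ℝ) : fstLinear d e (inlPoint e x) = x := by
  ext i; simp [fstLinear, inlPoint, LinearMap.funLeft]

@[simp] theorem fstLinear_inrPoint (x : Fin e → ℝ) : fstLinear d e (inrPoint d x) = 0 := by
  ext i; simp [fstLinear, inrPoint, LinearMap.funLeft]

@[simp] theorem sndLinear_inlPoint (x : Fin d → ℝ) : sndLinear d e (inlPoint e x) = 0 := by
  ext i; simp [sndLinear, inlPoint, LinearMap.funLeft]

@[simp] theorem sndLinear_inrPoint (x : Fin e → ℝ) : sndLinear d e (inrPoint d x) = x := by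
  ext i; simp [sndLinear, inrPoint, LinearMap.funLeft]

theorem inlPoint_add_inrPoint (γ : Fin (d + e) → ℝ) :
    inlPoint e (fstLinear d e γ) + inrPoint d (sndLinear d e γ) = γ := by
  ext i
  refine Fin.addCases (fun i => ?_) (fun i => ?_) i <;>
    simp [inlPoint, inrPoint, fstLinear, sndLinear, LinearMap.funLeft]

theorem fstLinear_mem_intLattice {γ : Fin (d + e) → ℝ} (h : γ ∈ intLattice (d + e)) :
    fstLinear d e γ ∈ intLattice d := fun i => h (Fin.castAdd e i)

theorem sndLinear_mem_intLattice {γ : Fin (d + e) → ℝ} (h : γ ∈ intLattice (d + e)) :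
    sndLinear d e γ ∈ intLattice e := fun i => h (Fin.natAdd d i)

theorem inlPoint_mem_intLattice {x : Fin d → ℝ} (h : x ∈ intLattice d) :
    inlPoint e x ∈ intLattice (d + e) := fun i => by
  refine Fin.addCases (fun i => ?_) (fun i => ?_) i
  · simpa [inlPoint] using h i
  · exact ⟨0, by simp [inlPoint]⟩

theorem inrPoint_mem_intLattice {x : Fin e → ℝ} (h : x ∈ intLattice e) :
    inrPoint d x ∈ intLattice (d + e) := fun i => by
  refine Fin.addCases (fun i => ?_) (fun i => ?_) i
  · exact ⟨0, by simp [inrPoint]⟩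
  · simpa [inrPoint] using h i

end Coordinates

/-! ### Dilates of the free sum -/

theorem Convex.smul_subset_smul {E : Type*} [AddCommGroup E] [Module ℝ E] {K : Set E}
    (hK : Convex ℝ K) (h0 : (0 : E) ∈ K) {s t : ℝ} (hs : 0 ≤ s) (hst : s ≤ t) :
    s • K ⊆ t • K := by
  intro x hx
  have : t • K = s • K + (t - s) • K := by
    rw [← hK.add_smul hs (sub_nonneg.2 hst), add_sub_cancel]
  rw [this]
  exact ⟨x, hx, 0, ⟨0, h0, smul_zero _⟩, add_zero x⟩

section FreeSum

variable {d e : ℕ} {P : Set (Fin d → ℝ)} {Q : Set (Fin e → ℝ)}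

theorem add_mem_smul_freeSum {t s : ℝ} (ht : 0 ≤ t) (hs : 0 ≤ s) {α : Fin d → ℝ}
    {β : Fin e → ℝ} (hα : α ∈ t • P) (hβ : β ∈ s • Q) :
    inlPoint e α + inrPoint d β ∈ (t + s) • freeSum P Q := by
  obtain ⟨p, hp, rfl⟩ := hα
  obtain ⟨q, hq, rfl⟩ := hβ
  rw [freeSum, (convex_convexHull ℝ _).add_smul ht hs]
  refine Set.add_mem_add ⟨inlPoint e p, subset_convexHull ℝ _ (Or.inl ⟨p, hp, rfl⟩), ?_⟩
    ⟨inrPoint d q, subset_convexHull ℝ _ (Or.inr ⟨q, hq, rfl⟩), ?_⟩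
  · exact ((inlLinear d e).map_smul t p).symm
  · exact ((inrLinear d e).map_smul s q).symm

theorem exists_of_mem_smul_freeSum (hP : Convex ℝ P) (hQ : Convex ℝ Q) (hP0 : P.Nonempty)
    (hQ0 : Q.Nonempty) {r : ℝ} (hr : 0 ≤ r) {γ : Fin (d + e) → ℝ}
    (hγ : γ ∈ r • freeSum P Q) :
    ∃ t s : ℝ, 0 ≤ t ∧ 0 ≤ s ∧ t + s = r ∧ fstLinear d e γ ∈ t • P ∧ sndLinear d e γ ∈ s • Q := by
  obtain ⟨x, hx, rfl⟩ := hγ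
  change x ∈ convexHull ℝ (inlLinear d e '' P ∪ inrLinear d e '' Q) at hx
  rw [Convex.convexHull_union (hP.linear_image (inlLinear d e))
    (hQ.linear_image (inrLinear d e)) (hP0.image _) (hQ0.image _), mem_convexJoin] at hx
  obtain ⟨_, ⟨p, hp, rfl⟩, _, ⟨q, hq, rfl⟩, a, b, ha, hb, hab, rfl⟩ := hx
  refine ⟨r * a, r * b, by positivity, by positivity, by rw [← mul_add, hab, mul_one],
    ⟨p, hp, ?_⟩, ⟨q, hq, ?_⟩⟩ <;> simp [mul_smul]

theorem IsSumOf.exists_split {A : Set (Fin d → ℝ)} {B : Set (Fin e → ℝ)} {n : ℕ}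
    {γ : Fin (d + e) → ℝ} (h : IsSumOf (inlPoint e '' A ∪ inrPoint d '' B) n γ) :
    ∃ k l : ℕ, k + l = n ∧ IsSumOf A k (fstLinear d e γ) ∧ IsSumOf B l (sndLinear d e γ) := by
  induction n generalizing γ with
  | zero =>
    rw [IsSumOf.zero_iff] at h
    exact ⟨0, 0, rfl, by simp [h, IsSumOf.zero_iff], by simp [h, IsSumOf.zero_iff]⟩
  | succ n ih =>
    obtain ⟨a, ha, y, hy, rfl⟩ := h.exists_of_succ
    obtain ⟨k, l, hkl, hk, hl⟩ := ih hy
    rcases ha with ⟨x, hx, rfl⟩ | ⟨x, hx, rfl⟩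
    · exact ⟨k + 1, l, by omega, by simpa using hk.succ hx, by simpa using hl⟩
    · exact ⟨k, l + 1, by omega, by simpa using hk, by simpa using hl.succ hx⟩

end FreeSum

/-- If one summand has unit facet equations, the two dilation factors can be made integral. -/
theorem exists_nat_smul {d e : ℕ} {P : Set (Fin d → ℝ)} {Q : Set (Fin e → ℝ)}
    (hP : IsIntegralPolytope P) (hdim : polytopeDim P = d) (hP0 : (0 : Fin d → ℝ) ∈ P)
    (hunit : HasUnitFacetEquations P) (hQ : Convex ℝ Q) (hQ0 : (0 : Fin e → ℝ) ∈ Q)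
    {t s : ℝ} (ht : 0 ≤ t) (hs : 0 ≤ s) {n : ℕ} (hts : t + s = n) {α : Fin d → ℝ}
    {β : Fin e → ℝ} (hα : α ∈ intLattice d) (hαt : α ∈ t • P) (hβ : β ∈ s • Q) :
    ∃ k l : ℕ, k + l = n ∧ α ∈ (k : ℝ) • P ∧ β ∈ (l : ℝ) • Q := by
  have hfl := Nat.floor_le ht
  have hle : ⌊t⌋₊ ≤ n := by
    have : (⌊t⌋₊ : ℝ) ≤ n := by linarith
    exact_mod_cast this
  refine ⟨⌊t⌋₊, n - ⌊t⌋₊, by omega, mem_floor_smul hP hdim hP0 hunit ht hα hαt, ?_⟩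
  refine hQ.smul_subset_smul hQ0 hs ?_ hβ
  rw [Nat.cast_sub hle]
  linarith

/-! ### The equivalence -/

theorem mainTheorem1 (d e : ℕ) (P : Set (Fin d → ℝ)) (Q : Set (Fin e → ℝ))
    (hP : IsIntegralPolytope P) (hQ : IsIntegralPolytope Q)
    (hPdim : polytopeDim P = d) (hQdim : polytopeDim Q = e)
    (hP0 : (0 : Fin d → ℝ) ∈ P) (hQ0 : (0 : Fin e → ℝ) ∈ Q)
    (hPspan : AddSubgroup.closure (latticePoints P) = intLattice d)
    (hQspan : AddSubgroup.closure (latticePoints Q) = intLattice e)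
    (hPQ : latticePoints (freeSum P Q) =
      inlPoint e '' latticePoints P ∪ inrPoint d '' latticePoints Q) :
    HasIDP (freeSum P Q) ↔
      (HasIDP P ∧ HasIDP Q) ∧ (HasUnitFacetEquations P ∨ HasUnitFacetEquations Q) := by
  have hPc : Convex ℝ P := by
    obtain ⟨S, rfl, -⟩ := hP.exists_finset
    exact convex_convexHull ℝ _
  have hQc : Convex ℝ Q := by
    obtain ⟨S, rfl, -⟩ := hQ.exists_finset
    exact convex_convexHull ℝ _
  have hP0' : (0 : Fin d → ℝ) ∈ latticePoints P := ⟨hP0, zero_mem _⟩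
  have hQ0' : (0 : Fin e → ℝ) ∈ latticePoints Q := ⟨hQ0, zero_mem _⟩
  constructor
  · intro h
    -- IDP of the free sum turns real dilation factors into integer numbers of summands; slack in t
    -- + s ≤ n is harmless because the free sum contains the origin.
    have split : ∀ (n : ℕ) (α : Fin d → ℝ) (β : Fin e → ℝ) (t s : ℝ), 0 ≤ t → 0 ≤ s →
        t + s ≤ n → α ∈ intLattice d → β ∈ intLattice e → α ∈ t • P → β ∈ s • Q →
        ∃ k l : ℕ, k + l = n ∧ IsSumOf (latticePoints P) k α ∧
          IsSumOf (latticePoints Q) l β := by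
      intro n α β t s ht hs hts hα hβ hαt hβs
      have h0 : (0 : Fin (d + e) → ℝ) ∈ freeSum P Q :=
        subset_convexHull ℝ _ (Or.inl ⟨0, hP0, (inlLinear d e).map_zero⟩)
      have hmem := (convex_convexHull ℝ _).smul_subset_smul h0 (add_nonneg ht hs) hts
        (add_mem_smul_freeSum ht hs hαt hβs)
      have := h.isSumOf (add_mem (inlPoint_mem_intLattice hα) (inrPoint_mem_intLattice hβ)) hmem
      rw [hPQ] at this
      simpa using this.exists_split
    refine ⟨⟨fun n _ γ hγ => ?_, fun n _ γ hγ => ?_⟩, ?_⟩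
    · obtain ⟨k, l, rfl, hk, -⟩ := split n γ 0 n 0 (by positivity) le_rfl (by simp) hγ.2
        (zero_mem _) hγ.1 ⟨0, hQ0, smul_zero _⟩
      -- The `l` summands from `Q` are replaced by zeros to restore the count.
      have := hk.add (IsSumOf.zeros hP0' l)
      rwa [add_zero] at this
    · obtain ⟨k, l, rfl, -, hl⟩ := split n 0 γ 0 n le_rfl (by positivity) (by simp)
        (zero_mem _) hγ.2 ⟨0, hP0, smul_zero _⟩ hγ.1
      have := (IsSumOf.zeros hQ0' k).add hl
      rwa [zero_add] at this
    · by_contra! hcon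
      obtain ⟨u, α, huP, hα, hα0, hαP, hf0, hf1⟩ :=
        exists_lattice_ray_fract hP hPdim hP0 hcon.1
      obtain ⟨w, β, hwQ, hβ, hβ0, hβQ, hg0, hg1⟩ :=
        exists_lattice_ray_fract hQ hQdim hQ0 hcon.2
      have hu := Int.floor_add_fract (u α)
      have hw := Int.floor_add_fract (w β)
      have hun := Int.floor_nonneg.2 hα0
      have hwn := Int.floor_nonneg.2 hβ0
      obtain ⟨a, ha⟩ := Int.eq_ofNat_of_zero_le hun
      obtain ⟨b, hb⟩ := Int.eq_ofNat_of_zero_le hwn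
      rw [ha, Int.cast_natCast] at hu
      rw [hb, Int.cast_natCast] at hw
      -- Both fractional parts are at most 1/2, so a + b + 1 suffices as dilation; both are
      -- positive, so k ≥ a + 1 and l ≥ b + 1, a contradiction.
      obtain ⟨k, l, hkl, hk, hl⟩ := split (a + b + 1) α β (u α) (w β) hα0 hβ0
        (by push_cast; linarith) hα hβ hαP hβQ
      have h1 := hk.map_le u (fun x hx => huP x hx.1)
      have h2 := hl.map_le w (fun x hx => hwQ x hx.1)
      have h3 : a < k := by
        have : (a : ℝ) < k := by linarith
        exact_mod_cast this
      have h4 : b < l := by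
        have : (b : ℝ) < l := by linarith
        exact_mod_cast this
      omega
  · rintro ⟨⟨hPI, hQI⟩, hunit⟩ n - γ ⟨hγ, hγZ⟩
    obtain ⟨t, s, ht, hs, hts, hα, hβ⟩ := exists_of_mem_smul_freeSum hPc hQc ⟨0, hP0⟩ ⟨0, hQ0⟩
      (Nat.cast_nonneg n) hγ
    have hαZ := fstLinear_mem_intLattice hγZ
    have hβZ := sndLinear_mem_intLattice hγZ
    obtain ⟨k, l, hkl, hk, hl⟩ : ∃ k l : ℕ, k + l = n ∧ fstLinear d e γ ∈ (k : ℝ) • P ∧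
        sndLinear d e γ ∈ (l : ℝ) • Q := by
      rcases hunit with h | h
      · exact exists_nat_smul hP hPdim hP0 h hQc hQ0 ht hs hts hαZ hα hβ
      · obtain ⟨l, k, hkl, hl, hk⟩ := exists_nat_smul hQ hQdim hQ0 h hPc hP0 hs ht
          ((add_comm s t).trans hts) hβZ hβ hα
        exact ⟨k, l, (add_comm k l).trans hkl, hk, hl⟩
    subst hkl
    have h1 : IsSumOf (latticePoints (freeSum P Q)) k (inlPoint e (fstLinear d e γ)) :=
      (hPI.isSumOf hαZ hk).map (inlLinear d e).toAddMonoidHom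
        (fun a ha => hPQ ▸ Or.inl ⟨a, ha, rfl⟩)
    have h2 : IsSumOf (latticePoints (freeSum P Q)) l (inrPoint d (sndLinear d e γ)) :=
      (hQI.isSumOf hβZ hl).map (inrLinear d e).toAddMonoidHom
        (fun a ha => hPQ ▸ Or.inr ⟨a, ha, rfl⟩)
    have := h1.add h2
    rwa [inlPoint_add_inrPoint] at this
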